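/- **State space collapse under MaxWeight.** Let $n\ge 1$, $0\le n_1,n_2\le n$, and write vectors of $\mathbb R^{n^2}$ as $x=(x_{ij})_{1\le i,j\le n}$, with the Euclidean norm. Let $e^{(i)}$ and $\tilde e^{(j)}$ be the indicator vectors of row $i$ and of column $j$. Let $$\mathcal C=\Bigl\{x\in\mathbb R_+^{n^2}:\ \sum_j x_{ij}\le 1\ \forall i,\ \sum_i x_{ij}\le 1\ \forall j\Bigr\},\qquad \mathcal F_{n_1n_2}=\Bigl\{x\in\mathcal C:\ \sum_j x_{ij}=1\ \forall i\le n_1,\ \sum_i x_{ij}=1\ \forall j\le n_2\Bigr\}.$$ Let $\mathcal K_{n_1n_2}$ be the cone of all combinations with nonnegative coefficients of $e^{(i)}$ ($i\le n_1$) and $\tilde e^{(j)}$ ($j\le n_2$), and let $\mathcal S_{n_1n_2}$ be the linear span of these vectors. For $x\in\mathbb R^{n^2}$ put $x_{\perp\mathcal K}=x-x_{\parallel\mathcal K}$ and $x_{\perp\mathcal S}=x-x_{\parallel\mathcal S}$, where $x_{\parallel\mathcal K}$ is the point of $\mathcal K_{n_1n_2}$ nearest to $x$ and $x_{\parallel\mathcal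 S}$ is the orthogonal projection of $x$ onto $\mathcal S_{n_1n_2}$. *The switch.* In each slot $t=0,1,2,\dots$ a random array $a(t)$ of nonnegative integers arrives; the arrays $a(t)$ are i.i.d. over time, and $a(t)$ is independent of the queue lengths and schedules up to and including slot $t$ and of the earlier arrivals. The schedule $s(t)$ is an $n\times n$ permutation matrix chosen by MaxWeight: $\sum_{ij}q_{ij}(t)s_{ij}(t)\ge\sum_{ij}q_{ij}(t)s'_{ij}$ for every 0-1 matrix $s'$ with all row and column sums at most $1$ (ties are broken by any rule, possibly a random one). The queue lengths $q(t)\in\mathbb Z_+^{n^2}$ evolve by $q_{ij}(t+1)=\max\{q_{ij}(t)+a_{ij}(t)-s_{ij}(t),\,0\}$. *Statement.* Let $\nu$ be in the relative interior of $\mathcal F_{n_1n_2}$ with $\nu_{\min}=\min_{ij}\nu_{ij}>0$, let $a_{\max}\in\mathbb N$ and $\tilde\sigma\in\mathbb R$, and put $$\nu'_{\min}=\min\Bigl\{\nu_{\min},\ \min_{i>n_1}\bigl(1-\sum_j\nu_{ij}\bigr),\ \min_{j>n_2}\bigl(1-\sum_i\nu_{ij}\bigr)\Bigr\}$$ (a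 minimum over an empty set is omitted). Then there are constants $M_r\ge 0$ ($r=1,2,\dots$), depending only on $n,n_1,n_2,r,\tilde\sigma,\nu,a_{\max}$, such that the following holds for every $k\in\mathbb R_+^{n^2}$ with $\sum_{ij}k_{ij}=n$ and every $\epsilon\in(0,1)$ with $\epsilon\le\nu'_{\min}/(2\|k\|)$. If a switch under MaxWeight has arrivals with $a_{ij}(t)\le a_{\max}$ almost surely, $\mathbb E[a_{ij}(t)]=\nu_{ij}-\epsilon k_{ij}$ for all $i,j$ and $\sum_{ij}\mathrm{Var}(a_{ij}(t))\le\tilde\sigma^2$, and if its queue length process $q(t)$ converges in distribution to a steady state random vector $\bar q$, then for every $r\in\{1,2,\dots\}$ the two moments below are finite and $$\mathbb E\bigl[\|\bar q_{\perp\mathcal S}\|^r\bigr]\ \le\ \mathbb E\bigl[\|\bar q_{\perp\mathcal K}\|^r\bigr]\ \le\ (M_r)^r .$$ -/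

import Mathlib

open MeasureTheory ProbabilityTheory Filter Topology

noncomputable section

namespace Switch

/-- Vectors in `ℝ^(n²)`, indexed by pairs (input port, output port), with the Euclidean norm. -/
abbrev Vec (n : ℕ) : Type := EuclideanSpace ℝ (Fin n × Fin n)

/-- `n × n` arrays of natural numbers: queue lengths, arrivals, schedules. -/
abbrev Arr (n : ℕ) : Type := Fin n → Fin n → ℕ

/-- An array of natural numbers, seen as a real vector. -/
def toVec {n : ℕ} (x : Arr n) : Vec n := WithLp.toLp 2 fun p => (x p.1 p.2 : ℝ)

/-- The indicator vector `e^(i)` of row (input port) `i`. -/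
def rowVec {n : ℕ} (i : Fin n) : Vec n := WithLp.toLp 2 fun p => if p.1 = i then 1 else 0

/-- The indicator vector `ẽ^(j)` of column (output port) `j`. -/
def colVec {n : ℕ} (j : Fin n) : Vec n := WithLp.toLp 2 fun p => if p.2 = j then 1 else 0

/-! ### Capacity region, its faces, cone and subspace -/

/-- The capacity region: nonnegative vectors all of whose row and column sums are at most `1`. -/
def capacityRegion (n : ℕ) : Set (Vec n) :=
  {x | (∀ p, 0 ≤ x p) ∧ (∀ i, ∑ j, x (i, j) ≤ 1) ∧ ∀ j, ∑ i, x (i, j) ≤ 1}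

/-- The face of the capacity region on which the first `n₁` rows and the first `n₂` columns are
saturated (indices of `Fin n` start at `0`). -/
def face (n n₁ n₂ : ℕ) : Set (Vec n) :=
  {x | x ∈ capacityRegion n ∧ (∀ i : Fin n, (i : ℕ) < n₁ → ∑ j, x (i, j) = 1) ∧
    ∀ j : Fin n, (j : ℕ) < n₂ → ∑ i, x (i, j) = 1}

/-- `ν'_min`: the minimum of all entries `ν_ij`, of the slacks `1 - ⟨ν, e^(i)⟩` of the unsaturated
rows and of the slacks `1 - ⟨ν, ẽ^(j)⟩` of the unsaturated columns. For `n ≥ 1` this is the infimum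
of a nonempty finite set, hence a minimum. -/
def nuMin' {n : ℕ} (n₁ n₂ : ℕ) (ν : Vec n) : ℝ :=
  sInf ((Set.range fun p => ν p) ∪
    ((fun i : Fin n => 1 - ∑ j, ν (i, j)) '' {i : Fin n | n₁ ≤ (i : ℕ)} ∪
      (fun j : Fin n => 1 - ∑ i, ν (i, j)) '' {j : Fin n | n₂ ≤ (j : ℕ)}))

/-- The cone spanned by the `e^(i)`, `i ≤ n₁`, and the `ẽ^(j)`, `j ≤ n₂`. -/
def cone (n n₁ n₂ : ℕ) : Set (Vec n) :=
  {x | ∃ w w' : Fin n → ℝ, (∀ i, 0 ≤ w i) ∧ (∀ i : Fin n, n₁ ≤ (i : ℕ) → w i = 0) ∧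
    (∀ j, 0 ≤ w' j) ∧ (∀ j : Fin n, n₂ ≤ (j : ℕ) → w' j = 0) ∧
    x = ∑ i, w i • rowVec i + ∑ j, w' j • colVec j}

/-- The subspace spanned by the `e^(i)`, `i ≤ n₁`, and the `ẽ^(j)`, `j ≤ n₂`. -/
def subspace (n n₁ n₂ : ℕ) : Submodule ℝ (Vec n) :=
  Submodule.span ℝ
    (rowVec '' {i : Fin n | (i : ℕ) < n₁} ∪ colVec '' {j : Fin n | (j : ℕ) < n₂})

/-- A continuous coercive map on a closed set has a point whose image is nearest to `x`. -/
theorem exists_nearest_of_coercive {V E : Type*} [NormedAddCommGroup V] [ProperSpace V]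
    [NormedAddCommGroup E] {f : V → E} {W : Set V} (hf : Continuous f) (hW : IsClosed W)
    (h0 : (0 : V) ∈ W) (hf0 : f 0 = 0) (hb : ∀ w ∈ W, ‖w‖ ≤ ‖f w‖) (x : E) :
    ∃ w ∈ W, ∀ v ∈ W, ‖x - f w‖ ≤ ‖x - f v‖ := by
  obtain ⟨w, hw, hmin⟩ := ContinuousOn.exists_isMinOn' (f := fun w => ‖x - f w‖) (s := W)
    (by fun_prop) hW h0 (by
      have h1 : ∀ᶠ w in cocompact V, 2 * ‖x‖ ≤ ‖w‖ :=
        (tendsto_norm_cocompact_atTop).eventually_ge_atTop _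
      filter_upwards [h1.filter_mono inf_le_left,
        (eventually_principal.2 fun w hw => hw : ∀ᶠ w in 𝓟 W, w ∈ W).filter_mono
          inf_le_right] with w h1 h2
      have h3 := hb w h2
      have h4 := norm_sub_norm_le (f w) x
      rw [norm_sub_rev] at h4
      rw [hf0, sub_zero]
      linarith)
  exact ⟨w, hw, fun v hv => hmin hv⟩

/-- Every vector has a nearest point in the cone. -/
theorem exists_nearest_cone (n n₁ n₂ : ℕ) (x : Vec n) :
    ∃ y ∈ cone n n₁ n₂, ∀ z ∈ cone n n₁ n₂, ‖x - y‖ ≤ ‖x - z‖ := by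
  obtain ⟨w, hw, hmin⟩ := exists_nearest_of_coercive
    (f := fun w : (Fin n → ℝ) × (Fin n → ℝ) =>
      (∑ i, w.1 i • rowVec i + ∑ j, w.2 j • colVec j : Vec n))
    (W := {w | (∀ i, 0 ≤ w.1 i) ∧ (∀ i : Fin n, n₁ ≤ (i : ℕ) → w.1 i = 0) ∧
      (∀ j, 0 ≤ w.2 j) ∧ (∀ j : Fin n, n₂ ≤ (j : ℕ) → w.2 j = 0)})
    (by fun_prop)
    (by
      simp only [Set.ofPred_and, Set.ofPred_forall]
      refine (isClosed_iInter fun i => isClosed_le (by fun_prop) (by fun_prop)).inter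
        ((isClosed_iInter fun i => isClosed_iInter fun _ =>
          isClosed_eq (by fun_prop) (by fun_prop)).inter
        ((isClosed_iInter fun i => isClosed_le (by fun_prop) (by fun_prop)).inter
          (isClosed_iInter fun i => isClosed_iInter fun _ =>
            isClosed_eq (by fun_prop) (by fun_prop)))))
    (by simp) (by simp)
    (by
      rintro w ⟨h1, -, h3, -⟩
      have key : ∀ i, w.1 i + w.2 i ≤
          ‖(∑ i, w.1 i • rowVec i + ∑ j, w.2 j • colVec j : Vec n)‖ := fun i => by
        have := PiLp.norm_apply_le (∑ i, w.1 i • rowVec i + ∑ j, w.2 j • colVec j : Vec n) (i, i)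
        refine le_trans ?_ ((le_abs_self _).trans this)
        simp [rowVec, colVec]
      refine max_le ((pi_norm_le_iff_of_nonneg (norm_nonneg _)).2 fun i => ?_)
        ((pi_norm_le_iff_of_nonneg (norm_nonneg _)).2 fun i => ?_)
      · rw [Real.norm_of_nonneg (h1 i)]
        linarith [key i, h3 i]
      · rw [Real.norm_of_nonneg (h3 i)]
        linarith [key i, h1 i]) x
  refine ⟨_, ⟨w.1, w.2, hw.1, hw.2.1, hw.2.2.1, hw.2.2.2, rfl⟩, ?_⟩
  rintro z ⟨v, v', h1, h2, h3, h4, rfl⟩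
  exact hmin (v, v') ⟨h1, h2, h3, h4⟩

/-- The projection `x_∥K` of `x` onto the cone: the point of the cone nearest to `x`. -/
def coneProj {n : ℕ} (n₁ n₂ : ℕ) (x : Vec n) : Vec n :=
  Classical.choose (exists_nearest_cone n n₁ n₂ x)

/-- `x_⊥K = x - x_∥K`. -/
def perpCone {n : ℕ} (n₁ n₂ : ℕ) (x : Vec n) : Vec n := x - coneProj n₁ n₂ x

/-- `x_⊥S = x - x_∥S`, where `x_∥S` is the orthogonal projection of `x` onto the subspace. -/
def perpSubspace {n : ℕ} (n₁ n₂ : ℕ) (x : Vec n) : Vec n :=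
  x - (subspace n n₁ n₂).starProjection x

/-! ### The switch -/

/-- Feasible schedules: 0-1 matrices with at most one `1` in each row and column. -/
def feasibleSchedules (n : ℕ) : Set (Arr n) :=
  {s | (∀ i, ∑ j, s i j ≤ 1) ∧ ∀ j, ∑ i, s i j ≤ 1}

/-- Maximal schedules: permutation matrices. -/
def maximalSchedules (n : ℕ) : Set (Arr n) :=
  {s | (∀ i, ∑ j, s i j = 1) ∧ ∀ j, ∑ i, s i j = 1}

/-- The weight `⟨q, s⟩` of the schedule `s` when the queue lengths are `q`. -/
def weight {n : ℕ} (q s : Arr n) : ℕ := ∑ i, ∑ j, q i j * s i j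

/-- The information available when the arrivals of slot `t` occur: queue lengths and schedules up to
and including slot `t`, and arrivals of the earlier slots. -/
@[reducible] def past {n : ℕ} {Ω : Type*} (a s q : ℕ → Ω → Arr n) (t : ℕ) : MeasurableSpace Ω :=
  (⨆ u ≤ t, MeasurableSpace.comap (q u) inferInstance) ⊔
    (⨆ u ≤ t, MeasurableSpace.comap (s u) inferInstance) ⊔
    (⨆ u < t, MeasurableSpace.comap (a u) inferInstance)

/-- `a t i j` packets arrive in slot `t` at input port `i` for output port `j`, the schedule `s t` is
used in slot `t`, and `q t` are the queue lengths at the beginning of slot `t`. The arrivals are i.i.d.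
over time and independent of the past of the switch. The schedules are chosen by
MaxWeight, with an arbitrary (possibly randomized) rule for breaking ties. -/
structure IsMaxWeightSwitch {n : ℕ} {Ω : Type*} [MeasurableSpace Ω] (P : Measure Ω)
    (a s q : ℕ → Ω → Arr n) : Prop where
  measurable_arrival : ∀ t, Measurable (a t)
  measurable_schedule : ∀ t, Measurable (s t)
  measurable_queue : ∀ t, Measurable (q t)
  identDistrib : ∀ t, IdentDistrib (a t) (a 0) P P
  indep_time : iIndepFun a P
  indep_past : ∀ t, Indep (MeasurableSpace.comap (a t) inferInstance) (past a s q t) P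
  schedule_maximal : ∀ t ω, s t ω ∈ maximalSchedules n
  maxWeight : ∀ t ω, ∀ s' ∈ feasibleSchedules n, weight (q t ω) s' ≤ weight (q t ω) (s t ω)
  /-- `q(t+1) = [q(t) + a(t) - s(t)]⁺`; subtraction on `ℕ` is truncated at `0`. -/
  queue_step : ∀ t ω i j, q (t + 1) ω i j = q t ω i j + a t ω i j - s t ω i j

end Switch

end

noncomputable section

namespace Switch

variable {n : ℕ}


/-! ### Geometry of the cones -/

/-! The distance `Y` from the queue vector to the cone is a Lyapunov function. Let `p` be the
nearest cone point to `q` and `y = q - p`; optimality puts `y` in the polar cone and gives `⟨y, p⟩ ≥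
0`. If a rate `ν` has positive entries and slack in every row and column outside those generating
the cone, then `ν + (c/‖y‖) y` still lies in the capacity region for a suitable `c > 0`. By
Birkhoff's theorem MaxWeight maximizes `⟨q, ·⟩` over that whole region, so `⟨q, s⟩` is at least the
value there. Since `ν` and the permutation matrix `s` both saturate the generating rows and columns,
the component along `p` cancels and `⟨y, ν - s⟩ ≤ -c‖y‖` (`HasMargin.inner_sub_le`).

As increments are bounded, this drift makes `E exp(θY)` contract geometrically up to an additive
constant. The initial queue need not have an exponential moment, so the recursion is run on events
where the initial distance is bounded, and a truncation argument carries the bound to the limit in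
distribution (`lintegral_limit_le`).

It remains to make the constants uniform in `k` and `ε`. A margin `c` requires slack `n * c`, so the
ball of radius `c/2` about `ν` need not contain every admissible `ν - εk`. However, all these rates
lie in the compact set `rateSet`. Each of its points serves as its own reference rate, with its own
saturated rows `I` and columns `J`; these are among the first `n₁` and `n₂`, so distance to `coneOn
I J` dominates distance to the full cone. Finitely many balls cover the set, and the exponential
moment bounds all moments. -/

theorem inner_eq_sum (x y : Vec n) : inner ℝ x y = ∑ p, x p * y p := by
  simp [PiLp.inner_apply, mul_comm]

theorem inner_eq_sum_sum (x y : Vec n) : inner ℝ x y = ∑ i, ∑ j, x (i, j) * y (i, j) := by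
  rw [inner_eq_sum, Fintype.sum_prod_type]

theorem inner_rowVec (x : Vec n) (i : Fin n) : inner ℝ x (rowVec i) = ∑ j, x (i, j) := by
  rw [inner_eq_sum_sum, Finset.sum_eq_single i]
  · simp [rowVec]
  · intro b _ hb
    simp [rowVec, hb]
  · simp

theorem inner_colVec (x : Vec n) (j : Fin n) : inner ℝ x (colVec j) = ∑ i, x (i, j) := by
  rw [inner_eq_sum_sum]
  simp [colVec]

theorem norm_le_of_forall_abs_le {x : Vec n} {b : ℝ} (hb : 0 ≤ b) (h : ∀ p, |x p| ≤ b) :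
    ‖x‖ ≤ n * b := by
  refine abs_le_of_sq_le_sq' ?_ (by positivity) |>.2
  rw [EuclideanSpace.norm_sq_eq]
  calc ∑ p, ‖x p‖ ^ 2 ≤ ∑ _p : Fin n × Fin n, b ^ 2 :=
        Finset.sum_le_sum fun p _ => by
          rw [Real.norm_eq_abs]
          exact pow_le_pow_left₀ (abs_nonneg _) (h p) 2
    _ = (n * b) ^ 2 := by simp; ring

/-- The cone spanned by the `e^(i)`, `i ∈ I`, and the `ẽ^(j)`, `j ∈ J`. -/
def coneOn (I J : Set (Fin n)) : Set (Vec n) :=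
  {x | ∃ w w' : Fin n → ℝ, (∀ i, 0 ≤ w i) ∧ (∀ i, i ∉ I → w i = 0) ∧
    (∀ j, 0 ≤ w' j) ∧ (∀ j, j ∉ J → w' j = 0) ∧
    x = ∑ i, w i • rowVec i + ∑ j, w' j • colVec j}

theorem coneOn_subset_cone {n₁ n₂ : ℕ} {I J : Set (Fin n)} (hI : ∀ i ∈ I, (i : ℕ) < n₁)
    (hJ : ∀ j ∈ J, (j : ℕ) < n₂) : coneOn I J ⊆ cone n n₁ n₂ := by
  rintro x ⟨w, w', h1, h2, h3, h4, rfl⟩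
  exact ⟨w, w', h1, fun i hi => h2 i fun h => absurd (hI i h) (not_lt.2 hi), h3,
    fun j hj => h4 j fun h => absurd (hJ j h) (not_lt.2 hj), rfl⟩

theorem cone_subset_subspace (n₁ n₂ : ℕ) : cone n n₁ n₂ ⊆ subspace n n₁ n₂ := by
  rintro x ⟨w, w', -, h2, -, h4, rfl⟩
  refine add_mem (sum_mem fun i _ => ?_) (sum_mem fun j _ => ?_)
  · by_cases hi : (i : ℕ) < n₁
    · exact Submodule.smul_mem _ _ (Submodule.subset_span (Or.inl ⟨i, hi, rfl⟩))
    · simp [h2 i (not_lt.1 hi)]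
  · by_cases hj : (j : ℕ) < n₂
    · exact Submodule.smul_mem _ _ (Submodule.subset_span (Or.inr ⟨j, hj, rfl⟩))
    · simp [h4 j (not_lt.1 hj)]

theorem exists_nearest_coneOn (I J : Set (Fin n)) (x : Vec n) :
    ∃ y ∈ coneOn I J, ∀ z ∈ coneOn I J, ‖x - y‖ ≤ ‖x - z‖ := by
  obtain ⟨w, hw, hmin⟩ := exists_nearest_of_coercive
    (f := fun w : (Fin n → ℝ) × (Fin n → ℝ) =>
      (∑ i, w.1 i • rowVec i + ∑ j, w.2 j • colVec j : Vec n))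
    (W := {w | (∀ i, 0 ≤ w.1 i) ∧ (∀ i, i ∉ I → w.1 i = 0) ∧
      (∀ j, 0 ≤ w.2 j) ∧ (∀ j, j ∉ J → w.2 j = 0)})
    (by fun_prop)
    (by
      simp only [Set.ofPred_and, Set.ofPred_forall]
      refine (isClosed_iInter fun i => isClosed_le (by fun_prop) (by fun_prop)).inter
        ((isClosed_iInter fun i => isClosed_iInter fun _ =>
          isClosed_eq (by fun_prop) (by fun_prop)).inter
        ((isClosed_iInter fun i => isClosed_le (by fun_prop) (by fun_prop)).inter
          (isClosed_iInter fun i => isClosed_iInter fun _ =>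
            isClosed_eq (by fun_prop) (by fun_prop)))))
    (by simp) (by simp)
    (by
      rintro w ⟨h1, -, h3, -⟩
      -- The diagonal entry `(i, i)` of the combination is `w.1 i + w.2 i`; with nonnegative weights
      -- it controls each of them, which gives coercivity even though the generators may be linearly
      -- dependent.
      have key : ∀ i, w.1 i + w.2 i ≤
          ‖(∑ i, w.1 i • rowVec i + ∑ j, w.2 j • colVec j : Vec n)‖ := fun i => by
        have := PiLp.norm_apply_le (∑ i, w.1 i • rowVec i + ∑ j, w.2 j • colVec j : Vec n) (i, i)
        refine le_trans ?_ ((le_abs_self _).trans this)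
        simp [rowVec, colVec]
      refine max_le ((pi_norm_le_iff_of_nonneg (norm_nonneg _)).2 fun i => ?_)
        ((pi_norm_le_iff_of_nonneg (norm_nonneg _)).2 fun i => ?_)
      · rw [Real.norm_of_nonneg (h1 i)]
        linarith [key i, h3 i]
      · rw [Real.norm_of_nonneg (h3 i)]
        linarith [key i, h1 i]) x
  refine ⟨_, ⟨w.1, w.2, hw.1, hw.2.1, hw.2.2.1, hw.2.2.2, rfl⟩, ?_⟩
  rintro z ⟨v, v', h1, h2, h3, h4, rfl⟩
  exact hmin (v, v') ⟨h1, h2, h3, h4⟩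

/-- The distance of a queue length array from `coneOn I J`. -/
def coneDist (I J : Set (Fin n)) (q : Arr n) : ℝ := Metric.infDist (toVec q) (coneOn I J)

theorem coneDist_nonneg (I J : Set (Fin n)) (q : Arr n) : 0 ≤ coneDist I J q :=
  Metric.infDist_nonneg

theorem abs_coneDist_sub_le (I J : Set (Fin n)) (q q' : Arr n) :
    |coneDist I J q' - coneDist I J q| ≤ ‖toVec q' - toVec q‖ := by
  rw [← Real.dist_eq, ← dist_eq_norm]
  exact (Metric.lipschitz_infDist_pt _).dist_le_mul _ _ |>.trans (by simp)

theorem coneDist_le {I J : Set (Fin n)} {q : Arr n} {z : Vec n} (hz : z ∈ coneOn I J) :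
    coneDist I J q ≤ ‖toVec q - z‖ := by
  rw [← dist_eq_norm]
  exact Metric.infDist_le_dist_of_mem hz

theorem exists_coneDist_eq (I J : Set (Fin n)) (q : Arr n) :
    ∃ p ∈ coneOn I J, coneDist I J q = ‖toVec q - p‖ ∧
      ∀ z ∈ coneOn I J, ‖toVec q - p‖ ≤ ‖toVec q - z‖ := by
  obtain ⟨p, hp, hmin⟩ := exists_nearest_coneOn I J (toVec q)
  refine ⟨p, hp, le_antisymm (coneDist_le hp) ?_, hmin⟩
  exact (Metric.le_infDist ⟨p, hp⟩).2 fun z hz => by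
    rw [dist_eq_norm]
    exact hmin z hz

/-- Fewer generators give a smaller cone, hence a larger distance. This is what allows the drift
argument to use a subset of the saturated rows and columns. -/
theorem norm_perpCone_le {n₁ n₂ : ℕ} {I J : Set (Fin n)} (hI : ∀ i ∈ I, (i : ℕ) < n₁)
    (hJ : ∀ j ∈ J, (j : ℕ) < n₂) (q : Arr n) :
    ‖perpCone n₁ n₂ (toVec q)‖ ≤ coneDist I J q := by
  obtain ⟨p, hp, h, -⟩ := exists_coneDist_eq I J q
  rw [h]
  exact (Classical.choose_spec (exists_nearest_cone n n₁ n₂ (toVec q))).2 p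
    (coneOn_subset_cone hI hJ hp)

theorem norm_perpSubspace_le (n₁ n₂ : ℕ) (x : Vec n) :
    ‖perpSubspace n₁ n₂ x‖ ≤ ‖perpCone n₁ n₂ x‖ := by
  have h := (Classical.choose_spec (exists_nearest_cone n n₁ n₂ x)).1
  rw [perpSubspace, Submodule.starProjection_minimal]
  exact ciInf_le ⟨0, by rintro _ ⟨_, rfl⟩; exact norm_nonneg _⟩
    (⟨_, cone_subset_subspace n₁ n₂ h⟩ : subspace n n₁ n₂)

/-! ### First-order optimality at the nearest point -/

theorem inner_nonpos_of_norm_le {E : Type*} [NormedAddCommGroup E] [InnerProductSpace ℝ E]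
    {y z : E} (h : ∀ t : ℝ, 0 < t → t ≤ 1 → ‖y‖ ≤ ‖y - t • z‖) : inner ℝ y z ≤ 0 := by
  by_contra! hpos
  have hz : 0 < ‖z‖ ^ 2 := by
    have : z ≠ 0 := fun h0 => by simp [h0] at hpos
    positivity
  -- The minimizer of `‖y - t • z‖`, capped at `1`; at this `t` the squared norm drops by at least
  -- `t * ⟨y, z⟩`.
  set t := min 1 (inner ℝ y z / ‖z‖ ^ 2) with ht
  have ht0 : 0 < t := lt_min one_pos (by positivity)
  have h1 := pow_le_pow_left₀ (norm_nonneg _) (h t ht0 (min_le_left _ _)) 2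
  rw [norm_sub_sq_real, norm_smul, inner_smul_right, mul_pow, Real.norm_eq_abs, sq_abs] at h1
  have h2 : t * ‖z‖ ^ 2 ≤ inner ℝ y z := (le_div_iff₀ hz).1 (min_le_right _ _)
  nlinarith [mul_pos ht0 hpos]

/-- The residual of the nearest point lies in the polar cone. -/
theorem sum_row_nonpos_of_nearest {I J : Set (Fin n)} {x p : Vec n} (hp : p ∈ coneOn I J)
    (hmin : ∀ z ∈ coneOn I J, ‖x - p‖ ≤ ‖x - z‖) {i : Fin n} (hi : i ∈ I) :
    ∑ j, (x - p) (i, j) ≤ 0 := by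
  rw [← inner_rowVec]
  refine inner_nonpos_of_norm_le fun t ht _ => ?_
  obtain ⟨w, w', h1, h2, h3, h4, rfl⟩ := hp
  rw [sub_sub]
  refine hmin _ ⟨w + Pi.single i t, w', fun k => ?_, fun k hk => ?_, h3, h4, ?_⟩
  · exact add_nonneg (h1 k) (by by_cases hk : k = i <;> simp [hk, ht.le])
  · have : k ≠ i := fun h => hk (h ▸ hi)
    simp [h2 k hk, this]
  · simp only [Pi.add_apply, add_smul, Finset.sum_add_distrib, Pi.single_apply, ite_smul, zero_smul,
      Finset.sum_ite_eq', Finset.mem_univ, if_true]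
    abel

theorem sum_col_nonpos_of_nearest {I J : Set (Fin n)} {x p : Vec n} (hp : p ∈ coneOn I J)
    (hmin : ∀ z ∈ coneOn I J, ‖x - p‖ ≤ ‖x - z‖) {j : Fin n} (hj : j ∈ J) :
    ∑ i, (x - p) (i, j) ≤ 0 := by
  rw [← inner_colVec]
  refine inner_nonpos_of_norm_le fun t ht _ => ?_
  obtain ⟨w, w', h1, h2, h3, h4, rfl⟩ := hp
  rw [sub_sub]
  refine hmin _ ⟨w, w' + Pi.single j t, h1, h2, fun k => ?_, fun k hk => ?_, ?_⟩
  · exact add_nonneg (h3 k) (by by_cases hk : k = j <;> simp [hk, ht.le])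
  · have : k ≠ j := fun h => hk (h ▸ hj)
    simp [h4 k hk, this]
  · simp only [Pi.add_apply, add_smul, Finset.sum_add_distrib, Pi.single_apply, ite_smul, zero_smul,
      Finset.sum_ite_eq', Finset.mem_univ, if_true]
    abel

/-- Shrinking `p` to `(1 - t) • p` stays in the cone, so the direction `-p` cannot bring the point
closer to `x`. -/
theorem inner_nearest_nonneg {I J : Set (Fin n)} {x p : Vec n} (hp : p ∈ coneOn I J)
    (hmin : ∀ z ∈ coneOn I J, ‖x - p‖ ≤ ‖x - z‖) : 0 ≤ inner ℝ (x - p) p := by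
  have : inner ℝ (x - p) (-p) ≤ 0 := by
    refine inner_nonpos_of_norm_le fun t ht ht1 => ?_
    obtain ⟨w, w', h1, h2, h3, h4, rfl⟩ := hp
    rw [sub_sub]
    refine hmin _ ⟨(1 - t) • w, (1 - t) • w', fun k => ?_, fun k hk => ?_, fun k => ?_,
      fun k hk => ?_, ?_⟩
    · exact mul_nonneg (by linarith) (h1 k)
    · simp [h2 k hk]
    · exact mul_nonneg (by linarith) (h3 k)
    · simp [h4 k hk]
    · simp only [Pi.smul_apply, smul_eq_mul, mul_smul, ← Finset.smul_sum, ← smul_add]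
      module
  rw [inner_neg_right] at this
  linarith

theorem coneOn_nonneg {I J : Set (Fin n)} {p : Vec n} (hp : p ∈ coneOn I J) (e : Fin n × Fin n) :
    0 ≤ p e := by
  obtain ⟨w, w', h1, h2, h3, h4, rfl⟩ := hp
  simp [rowVec, colVec, add_nonneg, h1, h3]

theorem inner_coneOn_eq {I J : Set (Fin n)} {p : Vec n} (hp : p ∈ coneOn I J) {x y : Vec n}
    (hr : ∀ i ∈ I, ∑ j, x (i, j) = ∑ j, y (i, j))
    (hc : ∀ j ∈ J, ∑ i, x (i, j) = ∑ i, y (i, j)) : inner ℝ x p = inner ℝ y p := by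
  obtain ⟨w, w', h1, h2, h3, h4, rfl⟩ := hp
  simp only [inner_add_right, inner_sum, inner_smul_right, inner_rowVec, inner_colVec]
  congr 1
  · refine Finset.sum_congr rfl fun i _ => ?_
    by_cases hi : i ∈ I
    · rw [hr i hi]
    · simp [h2 i hi]
  · refine Finset.sum_congr rfl fun j _ => ?_
    by_cases hj : j ∈ J
    · rw [hc j hj]
    · simp [h4 j hj]

/-! ### MaxWeight schedules -/

theorem inner_toVec (q s : Arr n) : inner ℝ (toVec q) (toVec s) = weight q s := by
  rw [inner_eq_sum_sum]
  simp [toVec, weight]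

/-- A doubly substochastic vector is dominated by a doubly stochastic one. -/
theorem exists_doublyStochastic_ge {x : Vec n} (hx : x ∈ capacityRegion n) :
    ∃ A ∈ doublyStochastic ℝ (Fin n), ∀ i j, x (i, j) ≤ A i j := by
  obtain ⟨h0, hr, hc⟩ := hx
  set r : Fin n → ℝ := fun i => 1 - ∑ j, x (i, j) with hrdef
  set c : Fin n → ℝ := fun j => 1 - ∑ i, x (i, j) with hcdef
  have hr0 : ∀ i, 0 ≤ r i := fun i => sub_nonneg.2 (hr i)
  have hc0 : ∀ j, 0 ≤ c j := fun j => sub_nonneg.2 (hc j)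
  have hrc : ∑ i, r i = ∑ j, c j := by
    simp only [hrdef, hcdef, Finset.sum_sub_distrib]
    rw [Finset.sum_comm]
  have hT : 0 ≤ ∑ i, r i := Finset.sum_nonneg fun i _ => hr0 i
  -- The deficits are filled by a rank-one matrix with row sums `r` and column sums `c`. If the
  -- total deficit is zero, all deficits vanish and division by zero adds nothing.
  refine ⟨Matrix.of fun i j => x (i, j) + r i * c j / ∑ i, r i, ?_, fun i j =>
    le_add_of_nonneg_right (div_nonneg (mul_nonneg (hr0 i) (hc0 j)) hT)⟩
  rw [mem_doublyStochastic_iff_sum]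
  simp only [Matrix.of_apply]
  refine ⟨fun i j => add_nonneg (h0 _) (div_nonneg (mul_nonneg (hr0 i) (hc0 j)) hT), fun i => ?_,
    fun j => ?_⟩
  · rw [Finset.sum_add_distrib, ← Finset.sum_div, ← Finset.mul_sum, ← hrc]
    rcases hT.eq_or_lt with h | h
    · have := (Finset.sum_eq_zero_iff_of_nonneg fun i _ => hr0 i).1 h.symm i (Finset.mem_univ i)
      simp only [hrdef] at this
      rw [← h]
      simp
      linarith
    · rw [mul_div_cancel_right₀ _ h.ne']
      simp [hrdef]
  · rw [Finset.sum_add_distrib, ← Finset.sum_div, ← Finset.sum_mul]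
    rcases hT.eq_or_lt with h | h
    · have := (Finset.sum_eq_zero_iff_of_nonneg fun i _ => hc0 i).1 (hrc ▸ h.symm) j
        (Finset.mem_univ j)
      simp only [hcdef] at this
      rw [← h]
      simp
      linarith
    · rw [mul_div_cancel_left₀ _ h.ne']
      simp [hcdef]

/-- A MaxWeight schedule has the largest weight among all points of the capacity region. -/
theorem inner_le_weight {q s : Arr n} (hs : ∀ s' ∈ feasibleSchedules n, weight q s' ≤ weight q s)
    {x : Vec n} (hx : x ∈ capacityRegion n) : inner ℝ (toVec q) x ≤ weight q s := by
  obtain ⟨A, hA, hxA⟩ := exists_doublyStochastic_ge hx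
  have h1 : inner ℝ (toVec q) x ≤ ∑ i, ∑ j, (q i j : ℝ) * A i j := by
    rw [inner_eq_sum_sum]
    exact Finset.sum_le_sum fun i _ => Finset.sum_le_sum fun j _ =>
      mul_le_mul_of_nonneg_left (hxA i j) (Nat.cast_nonneg _)
  obtain ⟨w, hw0, hw1, rfl⟩ := exists_eq_sum_perm_of_mem_doublyStochastic hA
  refine h1.trans ?_
  have h2 : ∀ σ : Equiv.Perm (Fin n),
      ∑ i, ∑ j, (q i j : ℝ) * σ.permMatrix ℝ i j ≤ weight q s := fun σ => by
    have := hs (fun i j => if σ i = j then 1 else 0) ⟨fun i => by simp, fun j => by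
      simp [← Equiv.eq_symm_apply]⟩
    refine le_trans (le_of_eq ?_) (Nat.cast_le.2 this)
    simp [weight, Equiv.Perm.permMatrix, PEquiv.toMatrix_apply, eq_comm]
  calc ∑ i, ∑ j, (q i j : ℝ) * (∑ σ, w σ • σ.permMatrix ℝ) i j
      = ∑ σ, w σ * ∑ i, ∑ j, (q i j : ℝ) * σ.permMatrix ℝ i j := by
        simp only [Matrix.sum_apply, Matrix.smul_apply, smul_eq_mul, Finset.mul_sum]
        simp_rw [Finset.sum_comm (s := Finset.univ (α := Equiv.Perm (Fin n)))]
        exact Finset.sum_congr rfl fun i _ => Finset.sum_congr rfl fun j _ =>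
          Finset.sum_congr rfl fun σ _ => by ring
    _ ≤ ∑ σ, w σ * (weight q s : ℝ) :=
        Finset.sum_le_sum fun σ _ => mul_le_mul_of_nonneg_left (h2 σ) (hw0 σ)
    _ = weight q s := by rw [← Finset.sum_mul, hw1, one_mul]

/-- `c` is a margin of `ν` in the face where exactly the rows `I` and the columns `J` are
saturated. -/
structure HasMargin (I J : Set (Fin n)) (ν : Vec n) (c : ℝ) : Prop where
  pos : 0 < c
  le_entry : ∀ p, c ≤ ν p
  row_eq : ∀ i ∈ I, ∑ j, ν (i, j) = 1
  row_le : ∀ i ∉ I, ∑ j, ν (i, j) + n * c ≤ 1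
  col_eq : ∀ j ∈ J, ∑ i, ν (i, j) = 1
  col_le : ∀ j ∉ J, ∑ i, ν (i, j) + n * c ≤ 1

theorem sum_le_card_mul_norm_row (y : Vec n) (i : Fin n) : ∑ j, y (i, j) ≤ n * ‖y‖ := by
  refine (Finset.sum_le_card_nsmul _ _ ‖y‖ fun j _ => ?_).trans (by simp)
  exact (le_abs_self _).trans (PiLp.norm_apply_le y (i, j))

theorem sum_le_card_mul_norm_col (y : Vec n) (j : Fin n) : ∑ i, y (i, j) ≤ n * ‖y‖ := by
  refine (Finset.sum_le_card_nsmul _ _ ‖y‖ fun i _ => ?_).trans (by simp)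
  exact (le_abs_self _).trans (PiLp.norm_apply_le y (i, j))

/-- The perturbation has norm `c`, so it lowers no entry by more than `c` and raises no row or
column sum by more than `n * c`; saturated sums do not increase because `y` is polar to the cone. -/
theorem HasMargin.add_smul_mem {I J : Set (Fin n)} {ν : Vec n} {c : ℝ} (h : HasMargin I J ν c)
    {y : Vec n} (hy : y ≠ 0) (hr : ∀ i ∈ I, ∑ j, y (i, j) ≤ 0)
    (hc : ∀ j ∈ J, ∑ i, y (i, j) ≤ 0) : ν + (c / ‖y‖) • y ∈ capacityRegion n := by
  have hy0 : 0 < ‖y‖ := norm_pos_iff.2 hy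
  have hcy : 0 < c / ‖y‖ := div_pos h.pos hy0
  have hcy' : c / ‖y‖ * ‖y‖ = c := div_mul_cancel₀ _ hy0.ne'
  refine ⟨fun p => ?_, fun i => ?_, fun j => ?_⟩
  · have h1 := neg_le_of_abs_le (PiLp.norm_apply_le y p)
    have h2 := mul_le_mul_of_nonneg_left h1 hcy.le
    have h3 := h.le_entry p
    simp only [PiLp.add_apply, PiLp.smul_apply, smul_eq_mul]
    linarith
  · simp only [PiLp.add_apply, PiLp.smul_apply, smul_eq_mul, Finset.sum_add_distrib,
      ← Finset.mul_sum]
    by_cases hi : i ∈ I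
    · rw [h.row_eq i hi]
      linarith [mul_nonpos_of_nonneg_of_nonpos hcy.le (hr i hi)]
    · have h1 := mul_le_mul_of_nonneg_left (sum_le_card_mul_norm_row y i) hcy.le
      have h2 := h.row_le i hi
      rw [mul_left_comm, hcy'] at h1
      linarith
  · simp only [PiLp.add_apply, PiLp.smul_apply, smul_eq_mul, Finset.sum_add_distrib,
      ← Finset.mul_sum]
    by_cases hj : j ∈ J
    · rw [h.col_eq j hj]
      linarith [mul_nonpos_of_nonneg_of_nonpos hcy.le (hc j hj)]
    · have h1 := mul_le_mul_of_nonneg_left (sum_le_card_mul_norm_col y j) hcy.le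
      have h2 := h.col_le j hj
      rw [mul_left_comm, hcy'] at h1
      linarith

/-- Under MaxWeight the service exceeds `ν` in the direction orthogonal to the cone. -/
theorem HasMargin.inner_sub_le {I J : Set (Fin n)} {ν : Vec n} {c : ℝ} (h : HasMargin I J ν c)
    {q s : Arr n} (hs : s ∈ maximalSchedules n)
    (hmw : ∀ s' ∈ feasibleSchedules n, weight q s' ≤ weight q s) {p : Vec n}
    (hp : p ∈ coneOn I J) (hmin : ∀ z ∈ coneOn I J, ‖toVec q - p‖ ≤ ‖toVec q - z‖) :
    inner ℝ (toVec q - p) (ν - toVec s) ≤ -(c * ‖toVec q - p‖) := by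
  set y := toVec q - p with hy
  by_cases hy0 : y = 0
  · simp [hy0]
  have hpos : 0 < ‖y‖ := norm_pos_iff.2 hy0
  have h1 := inner_le_weight hmw (h.add_smul_mem hy0
    (fun i hi => sum_row_nonpos_of_nearest hp hmin hi)
    (fun j hj => sum_col_nonpos_of_nearest hp hmin hj))
  rw [← inner_toVec, inner_add_right, inner_smul_right] at h1
  -- `p` sees only the sums over `I` and `J`, which equal `1` for both vectors.
  have h2 : inner ℝ ν p = inner ℝ (toVec s) p := by
    refine inner_coneOn_eq hp (fun i hi => ?_) fun j hj => ?_
    · rw [h.row_eq i hi]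
      simp only [toVec]
      exact_mod_cast (hs.1 i).symm
    · rw [h.col_eq j hj]
      simp only [toVec]
      exact_mod_cast (hs.2 j).symm
  have h3 : 0 ≤ inner ℝ y p := inner_nearest_nonneg hp hmin
  have h4 : toVec q = y + p := by simp [hy]
  rw [h4] at h1
  simp only [inner_add_left, real_inner_self_eq_norm_sq] at h1
  have h5 : c / ‖y‖ * ‖y‖ ^ 2 = c * ‖y‖ := by field_simp
  have h6 : 0 ≤ c / ‖y‖ * inner ℝ y p := mul_nonneg (div_nonneg h.pos.le hpos.le) h3
  rw [real_inner_comm, real_inner_comm p (toVec s)] at h2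
  rw [real_inner_comm] at h6
  rw [inner_sub_right]
  linarith

/-! ### One step of the switch -/

/-- The queue lengths after one slot. -/
def nextQueue (q a s : Arr n) : Arr n := fun i j => q i j + a i j - s i j

theorem le_one_of_mem_maximalSchedules {s : Arr n} (hs : s ∈ maximalSchedules n) (i j : Fin n) :
    s i j ≤ 1 :=
  (hs.1 i) ▸ Finset.single_le_sum (f := fun j => s i j) (fun _ _ => Nat.zero_le _)
    (Finset.mem_univ j)

theorem norm_nextQueue_sub_le {q a s : Arr n} (hs : s ∈ maximalSchedules n) {b : ℕ}
    (ha : ∀ i j, a i j ≤ b) : ‖toVec (nextQueue q a s) - toVec q‖ ≤ n * (b + 1) := by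
  refine norm_le_of_forall_abs_le (by positivity) fun p => ?_
  have h1 := le_one_of_mem_maximalSchedules hs p.1 p.2
  have h2 := ha p.1 p.2
  have h3 : (nextQueue q a s p.1 p.2 : ℤ) - q p.1 p.2 ≤ b + 1 := by
    simp only [nextQueue]; omega
  have h4 : -((b : ℤ) + 1) ≤ (nextQueue q a s p.1 p.2 : ℤ) - q p.1 p.2 := by
    simp only [nextQueue]; omega
  simp only [toVec, PiLp.sub_apply]
  exact abs_le.2 ⟨by exact_mod_cast h4, by exact_mod_cast h3⟩

/-- The old nearest point `p` is a competitor for the new queue; expand the square. Unused service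
only helps because `p` has nonnegative entries. -/
theorem coneDist_nextQueue_sq_le {I J : Set (Fin n)} {q a s : Arr n}
    (hs : s ∈ maximalSchedules n) {b : ℕ} (ha : ∀ i j, a i j ≤ b) {p : Vec n}
    (hp : p ∈ coneOn I J) :
    coneDist I J (nextQueue q a s) ^ 2 ≤ ‖toVec q - p‖ ^ 2 +
      2 * inner ℝ (toVec q - p) (toVec a - toVec s) + (n * (b + 1)) ^ 2 := by
  have h1 := pow_le_pow_left₀ (coneDist_nonneg _ _ _)
    (coneDist_le (q := nextQueue q a s) hp) 2
  have h2 := pow_le_pow_left₀ (norm_nonneg _) (norm_nextQueue_sub_le (q := q) hs ha) 2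
  have h3 : toVec (nextQueue q a s) - p =
      (toVec q - p) + (toVec (nextQueue q a s) - toVec q) := by abel
  rw [h3, norm_add_sq_real] at h1
  have h4 : inner ℝ (toVec q - p) (toVec (nextQueue q a s) - toVec q) ≤
      inner ℝ (toVec q - p) (toVec a - toVec s) := by
    rw [inner_eq_sum, inner_eq_sum]
    refine Finset.sum_le_sum fun e _ => ?_
    have hs1 := le_one_of_mem_maximalSchedules hs e.1 e.2
    have hpe := coneOn_nonneg hp e
    simp only [toVec, PiLp.sub_apply, nextQueue]
    by_cases hle : s e.1 e.2 ≤ q e.1 e.2 + a e.1 e.2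
    · rw [Nat.cast_sub hle]
      push_cast
      apply le_of_eq
      ring
    -- Truncation occurs only when an empty queue without arrivals is served. There `q - p` has
    -- entry `-p e ≤ 0`, and replacing the actual increment `0` by `-1` can only increase the
    -- product.
    · have hq : q e.1 e.2 = 0 := by omega
      have ha0 : a e.1 e.2 = 0 := by omega
      have hs' : s e.1 e.2 = 1 := by omega
      simp [hq, ha0, hs']
      exact hpe
  linarith


theorem inner_toVec_right (y : Vec n) (a : Arr n) :
    inner ℝ y (toVec a) = ∑ p : Fin n × Fin n, y p * (a p.1 p.2 : ℝ) := by
  rw [inner_eq_sum]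
  rfl

/-- One-step bound far from the cone, before averaging over the arrivals. -/
theorem exp_coneDist_nextQueue_le {I J : Set (Fin n)} {q a s : Arr n}
    (hs : s ∈ maximalSchedules n) {b : ℕ} (ha : ∀ i j, a i j ≤ b) {p : Vec n}
    (hp : p ∈ coneOn I J) (hY : coneDist I J q = ‖toVec q - p‖) {c θ : ℝ} (hc : 0 < c)
    (hθ : 0 < θ) (hθD : θ * (n * (b + 1)) ≤ 1)
    (hfar : 2 * (n * (b + 1)) ^ 2 / c ≤ coneDist I J q) (hYpos : 0 < coneDist I J q) :
    Real.exp (θ * coneDist I J (nextQueue q a s)) ≤ Real.exp (θ * coneDist I J q) *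
      (1 + θ * (inner ℝ (toVec q - p) (toVec a - toVec s) / coneDist I J q + c / 4) +
        θ ^ 2 * (n * (b + 1)) ^ 2) := by
  set D : ℝ := n * (b + 1) with hD
  set Y := coneDist I J q with hYdef
  set Y' := coneDist I J (nextQueue q a s) with hYdef'
  have hD0 : 0 ≤ D := by positivity
  have hsq := coneDist_nextQueue_sq_le (q := q) hs ha hp
  rw [← hY, ← hYdef', ← hD] at hsq
  have hlip : |Y' - Y| ≤ D :=
    (abs_coneDist_sub_le I J _ _).trans (norm_nextQueue_sub_le hs ha)
  set g := inner ℝ (toVec q - p) (toVec a - toVec s) with hg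
  have hZ : Y' - Y ≤ g / Y + c / 4 := by
    have h1 : 2 * D ^ 2 ≤ Y * c := (div_le_iff₀ hc).1 hfar
    -- Uses `2Y(Y' - Y) ≤ Y'² - Y² ≤ 2g + D²`, and `D²/2 ≤ cY/4` far from the cone.
    have h2 : Y * (Y' - Y) ≤ g + c / 4 * Y := by nlinarith [sq_nonneg (Y' - Y)]
    have h3 : Y * (g / Y + c / 4) = g + c / 4 * Y := by field_simp
    exact le_of_mul_le_mul_left (h3 ▸ h2) hYpos
  have hx : |θ * (Y' - Y)| ≤ 1 := by
    rw [abs_mul, abs_of_pos hθ]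
    exact (mul_le_mul_of_nonneg_left hlip hθ.le).trans hθD
  have he := (abs_le.1 (Real.abs_exp_sub_one_sub_id_le hx)).2
  have hsq' : (θ * (Y' - Y)) ^ 2 ≤ θ ^ 2 * D ^ 2 := by
    rw [mul_pow, ← sq_abs (Y' - Y)]
    gcongr
  have hsplit : θ * Y' = θ * Y + θ * (Y' - Y) := by ring
  rw [hsplit, Real.exp_add]
  have := mul_le_mul_of_nonneg_left hZ hθ.le
  exact mul_le_mul_of_nonneg_left (by linarith) (Real.exp_pos _).le

/-- The average of the exponential of the distance contracts, up to an additive constant. -/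
theorem HasMargin.lintegral_exp_coneDist_nextQueue_le {I J : Set (Fin n)} {ν l : Vec n} {c : ℝ}
    (h : HasMargin I J ν c) (hl : ‖l - ν‖ ≤ c / 2) {q s : Arr n}
    (hs : s ∈ maximalSchedules n)
    (hmw : ∀ s' ∈ feasibleSchedules n, weight q s' ≤ weight q s)
    {b : ℕ} {Ω : Type*} [MeasurableSpace Ω] {P : Measure Ω} [IsProbabilityMeasure P]
    {a : Ω → Arr n} (hameas : Measurable a) (ha : ∀ i j, ∀ᵐ ω ∂P, a ω i j ≤ b)
    (hmean : ∀ i j, ∫ ω, (a ω i j : ℝ) ∂P = l (i, j)) {θ : ℝ} (hθ : 0 < θ)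
    (hθD : θ * (n * (b + 1)) ≤ 1) (hθc : θ * (n * (b + 1)) ^ 2 ≤ c / 8) (hρ : θ * c ≤ 8) :
    ∫⁻ ω, ENNReal.ofReal (Real.exp (θ * coneDist I J (nextQueue q (a ω) s))) ∂P ≤
      ENNReal.ofReal ((1 - θ * c / 8) * Real.exp (θ * coneDist I J q) +
        Real.exp (θ * (2 * (n * (b + 1)) ^ 2 / c + n * (b + 1) + 1))) := by
  set D : ℝ := n * (b + 1) with hD
  set Y := coneDist I J q with hYdef
  have hD0 : 0 ≤ D := by positivity
  have hc := h.pos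
  have ha' : ∀ᵐ ω ∂P, ∀ i j, a ω i j ≤ b := by
    simpa only [ae_all_iff] using ha
  obtain ⟨p, hp, hY, hmin⟩ := exists_coneDist_eq I J q
  by_cases hfar : 2 * D ^ 2 / c + 1 ≤ Y
  -- The extra `1` in the threshold makes `Y` positive, so that dividing by it is legitimate.
  · have hdiv : 0 ≤ 2 * D ^ 2 / c := by positivity
    have hYpos : 0 < Y := by linarith
    set y := toVec q - p with hy
    set g : Ω → ℝ := fun ω => Real.exp (θ * Y) *
      (1 + θ * (inner ℝ y (toVec (a ω) - toVec s) / Y + c / 4) + θ ^ 2 * D ^ 2) with hg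
    have hle : ∀ᵐ ω ∂P, Real.exp (θ * coneDist I J (nextQueue q (a ω) s)) ≤ g ω := by
      filter_upwards [ha'] with ω hω
      exact exp_coneDist_nextQueue_le hs hω hp hY hc hθ hθD (by linarith) hYpos
    have hint : ∀ i j, Integrable (fun ω => (a ω i j : ℝ)) P := fun i j => by
      refine Integrable.of_bound (C := b) ?_ ?_
      · exact (measurable_from_top.comp
          ((measurable_pi_apply j).comp ((measurable_pi_apply i).comp hameas))
            : Measurable fun ω => (a ω i j : ℝ)).aestronglyMeasurable
      · filter_upwards [ha i j] with ω hω
        simpa using hω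
    have hint' : Integrable (fun ω => inner ℝ y (toVec (a ω))) P := by
      simp only [inner_toVec_right]
      exact integrable_finsetSum _ fun e _ => (hint e.1 e.2).const_mul _
    have hmean' : ∫ ω, inner ℝ y (toVec (a ω)) ∂P = inner ℝ y l := by
      simp only [inner_toVec_right]
      rw [integral_finsetSum _ fun e _ => (hint e.1 e.2).const_mul _, inner_eq_sum]
      exact Finset.sum_congr rfl fun e _ => by rw [integral_const_mul, hmean]
    have hgeq : g = fun ω => Real.exp (θ * Y) * θ / Y * inner ℝ y (toVec (a ω)) +
        Real.exp (θ * Y) *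
          (1 + θ * (-inner ℝ y (toVec s) / Y + c / 4) + θ ^ 2 * D ^ 2) := by
      funext ω
      simp only [hg, inner_sub_right]
      ring
    have hgint : Integrable g P := by
      rw [hgeq]
      exact (hint'.const_mul _).add (integrable_const _)
    have hgmean : ∫ ω, g ω ∂P = Real.exp (θ * Y) *
        (1 + θ * (inner ℝ y (l - toVec s) / Y + c / 4) + θ ^ 2 * D ^ 2) := by
      rw [hgeq, integral_add (hint'.const_mul _) (integrable_const _), integral_const_mul, hmean']
      simp only [inner_sub_right, integral_const, probReal_univ, one_smul]
      ring
    have hdrift : inner ℝ y (l - toVec s) / Y ≤ -c / 2 := by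
      rw [div_le_iff₀ hYpos]
      have h1 := h.inner_sub_le hs hmw hp hmin
      have h2 := (real_inner_le_norm y (l - ν)).trans
        (mul_le_mul_of_nonneg_left hl (norm_nonneg y))
      have h3 : l - toVec s = (l - ν) + (ν - toVec s) := by abel
      rw [h3, inner_add_right, hYdef, hY]
      linarith
    calc ∫⁻ ω, ENNReal.ofReal (Real.exp (θ * coneDist I J (nextQueue q (a ω) s))) ∂P
        ≤ ∫⁻ ω, ENNReal.ofReal (g ω) ∂P := lintegral_mono_ae <| by
          filter_upwards [hle] with ω hω using ENNReal.ofReal_le_ofReal hω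
      _ = ENNReal.ofReal (∫ ω, g ω ∂P) := by
          rw [ofReal_integral_eq_lintegral_ofReal hgint]
          filter_upwards [hle] with ω hω using (Real.exp_pos _).le.trans hω
      _ ≤ _ := by
          refine ENNReal.ofReal_le_ofReal ?_
          rw [hgmean]
          have h1 := mul_le_mul_of_nonneg_left hdrift hθ.le
          -- Budget: drift `-c/2`, curvature `c/4`, quadratic term `c/8`, leaving `-c/8`.
          have h2 : θ ^ 2 * D ^ 2 ≤ θ * (c / 8) := by
            have := mul_le_mul_of_nonneg_left hθc hθ.le
            linarith
          have h3 : Real.exp (θ * Y) *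
              (1 + θ * (inner ℝ y (l - toVec s) / Y + c / 4) + θ ^ 2 * D ^ 2) ≤
              Real.exp (θ * Y) * (1 - θ * c / 8) :=
            mul_le_mul_of_nonneg_left (by linarith) (Real.exp_pos _).le
          linarith [Real.exp_pos (θ * (2 * D ^ 2 / c + D + 1))]
  · calc ∫⁻ ω, ENNReal.ofReal (Real.exp (θ * coneDist I J (nextQueue q (a ω) s))) ∂P
        ≤ ∫⁻ _ω, ENNReal.ofReal (Real.exp (θ * (2 * D ^ 2 / c + D + 1))) ∂P := by
          refine lintegral_mono_ae ?_
          filter_upwards [ha'] with ω hω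
          refine ENNReal.ofReal_le_ofReal (Real.exp_le_exp.2 (mul_le_mul_of_nonneg_left ?_ hθ.le))
          have := (abs_le.1 ((abs_coneDist_sub_le I J q (nextQueue q (a ω) s)).trans
            (norm_nextQueue_sub_le hs hω))).2
          linarith
      _ ≤ _ := by
          rw [lintegral_const, measure_univ, mul_one]
          refine ENNReal.ofReal_le_ofReal (le_add_of_nonneg_left ?_)
          exact mul_nonneg (by linarith) (Real.exp_pos _).le

/-- Drift over one slot along the switch, on an event determined by the initial queue lengths. -/
theorem IsMaxWeightSwitch.lintegral_step {Ω : Type*} [MeasurableSpace Ω] {P : Measure Ω}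
    [IsProbabilityMeasure P] {a s q : ℕ → Ω → Arr n} (hsw : IsMaxWeightSwitch P a s q)
    (S : Set (Arr n)) (f : Arr n → ENNReal) {ρ B : ENNReal} (t : ℕ)
    (hstep : ∀ ω, ∫⁻ ω', f (nextQueue (q t ω) (a t ω') (s t ω)) ∂P ≤ ρ * f (q t ω) + B) :
    ∫⁻ ω, (q 0 ⁻¹' S).indicator (fun ω => f (q (t + 1) ω)) ω ∂P ≤
      ρ * ∫⁻ ω, (q 0 ⁻¹' S).indicator (fun ω => f (q t ω)) ω ∂P + B := by
  -- Including `q 0` makes the restricting event a function of `X`, which is independent of `a t`;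
  -- Fubini then averages over the arrivals with `X` frozen.
  set X : Ω → Arr n × Arr n × Arr n := fun ω => (q 0 ω, q t ω, s t ω) with hX
  have hXmeas : Measurable X :=
    (hsw.measurable_queue 0).prodMk ((hsw.measurable_queue t).prodMk (hsw.measurable_schedule t))
  have hle : MeasurableSpace.comap X inferInstance ≤ past a s q t := by
    rw [← measurable_iff_comap_le]
    have h1 : ∀ u ≤ t, Measurable[past a s q t] (q u) := fun u hu =>
      measurable_iff_comap_le.2 (le_sup_of_le_left (le_sup_of_le_left
        (le_iSup₂_of_le (f := fun u (_ : u ≤ t) => MeasurableSpace.comap (q u) inferInstance)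
          u hu le_rfl)))
    have h2 : Measurable[past a s q t] (s t) :=
      measurable_iff_comap_le.2 (le_sup_of_le_left (le_sup_of_le_right
        (le_iSup₂_of_le (f := fun u (_ : u ≤ t) => MeasurableSpace.comap (s u) inferInstance)
          t le_rfl le_rfl)))
    exact Measurable.prodMk (h1 0 (Nat.zero_le t)) (Measurable.prodMk (h1 t le_rfl) h2)
  have hind : IndepFun X (a t) P :=
    (indep_of_indep_of_le_left (hsw.indep_past t).symm hle)
  have hmap := (indepFun_iff_map_prod_eq_prod_map_map hXmeas.aemeasurable
    (hsw.measurable_arrival t).aemeasurable).1 hind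
  have hnext : ∀ ω, q (t + 1) ω = nextQueue (q t ω) (a t ω) (s t ω) := fun ω => by
    funext i j
    exact hsw.queue_step t ω i j
  set F : (Arr n × Arr n × Arr n) × Arr n → ENNReal := fun z =>
    (Prod.fst ⁻¹' S).indicator (fun x : Arr n × Arr n × Arr n => f (nextQueue x.2.1 z.2 x.2.2)) z.1
    with hF
  have hFm : Measurable F := Measurable.of_discrete
  calc ∫⁻ ω, (q 0 ⁻¹' S).indicator (fun ω => f (q (t + 1) ω)) ω ∂P
      = ∫⁻ ω, F (X ω, a t ω) ∂P := by
        refine lintegral_congr fun ω => ?_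
        simp only [hF, hX, Set.indicator, hnext]
        rfl
    _ = ∫⁻ z, F z ∂(P.map X).prod (P.map (a t)) := by
        rw [← hmap, lintegral_map hFm (hXmeas.prodMk (hsw.measurable_arrival t))]
    _ = ∫⁻ ω, ∫⁻ ω', F (X ω, a t ω') ∂P ∂P := by
        rw [lintegral_prod _ hFm.aemeasurable, lintegral_map Measurable.of_discrete hXmeas]
        refine lintegral_congr fun ω => ?_
        rw [lintegral_map Measurable.of_discrete (hsw.measurable_arrival t)]
    _ ≤ ∫⁻ ω, (ρ * (q 0 ⁻¹' S).indicator (fun ω => f (q t ω)) ω + B) ∂P := by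
        refine lintegral_mono fun ω => ?_
        by_cases hω : q 0 ω ∈ S
        · simpa [hF, hX, Set.indicator, hω] using hstep ω
        · simp [hF, hX, Set.indicator, hω]
    _ = _ := by
        have hm : Measurable ((q 0 ⁻¹' S).indicator fun ω => f (q t ω)) :=
          (Measurable.of_discrete.comp (hsw.measurable_queue t)).indicator
            (hsw.measurable_queue 0 MeasurableSet.of_discrete)
        rw [lintegral_add_right _ measurable_const, lintegral_const_mul _ hm, lintegral_const,
          measure_univ, mul_one]


/-! ### Passage to the steady state -/

/-- Bounds on `f (q t)`, each valid up to an exceptional initial event, pass to a limit in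
distribution. -/
theorem lintegral_limit_le {Ω Ω' : Type*} [MeasurableSpace Ω] [MeasurableSpace Ω'] {P : Measure Ω}
    [IsProbabilityMeasure P] {P' : Measure Ω'} [IsProbabilityMeasure P'] {q : ℕ → Ω → Arr n}
    {qbar : Ω' → Arr n} (hconv : TendstoInDistribution q atTop qbar (fun _ => P) P')
    (hq : ∀ t, Measurable (q t)) (f : Arr n → NNReal) (A : ℕ → Set Ω)
    (hA : ∀ R, MeasurableSet (A R)) (hA' : Tendsto (fun R => P (A R)ᶜ) atTop (𝓝 0))
    {K : ENNReal} (v : ℕ → ℕ → ENNReal) (hv : ∀ R, Tendsto (v R) atTop (𝓝 K))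
    (hbound : ∀ R t, ∫⁻ ω, (A R).indicator (fun ω => (f (q t ω) : ENNReal)) ω ∂P ≤ v R t) :
    ∫⁻ ω, f (qbar ω) ∂P' ≤ K := by
  -- On a discrete space the truncation is bounded and continuous. With `L` fixed, the exceptional
  -- event costs at most `L * P (A R)ᶜ`, which vanishes as `R → ∞`; only afterwards does `L` grow.
  have htrunc : ∀ L : ℕ, ∫⁻ ω, (min (f (qbar ω)) (L : NNReal) : NNReal) ∂P' ≤ K := by
    intro L
    let g : BoundedContinuousFunction (Arr n) NNReal :=
      BoundedContinuousFunction.mkOfBound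
        ⟨fun x => min (f x) (L : NNReal), continuous_of_discreteTopology⟩ L
        fun x y => by
          rw [NNReal.dist_eq, abs_le]
          have h1 : ∀ z, ((min (f z) (L : NNReal) : NNReal) : ℝ) ≤ L := fun z => by
            exact_mod_cast min_le_right (f z) (L : NNReal)
          have h2 := h1 x
          have h3 := h1 y
          have h4 := NNReal.coe_nonneg (min (f x) (L : NNReal))
          have h5 := NNReal.coe_nonneg (min (f y) (L : NNReal))
          constructor <;> simp only [ContinuousMap.coe_mk] <;> linarith
    have hlim := (ProbabilityMeasure.tendsto_iff_forall_lintegral_tendsto.1 hconv.tendsto) g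
    simp only [ProbabilityMeasure.coe_mk] at hlim
    have hgm : Measurable fun x => (g x : ENNReal) := Measurable.of_discrete
    rw [lintegral_map' hgm.aemeasurable hconv.aemeasurable_limit] at hlim
    simp only [lintegral_map hgm (hq _)] at hlim
    have hstep : ∀ R, ∫⁻ ω, g (qbar ω) ∂P' ≤ K + L * P (A R)ᶜ := fun R => by
      refine le_of_tendsto_of_tendsto' hlim ((hv R).add tendsto_const_nhds) fun t => ?_
      calc ∫⁻ ω, g (q t ω) ∂P
          ≤ ∫⁻ ω, ((A R).indicator (fun ω => (f (q t ω) : ENNReal)) ω +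
              (A R)ᶜ.indicator (fun _ => (L : ENNReal)) ω) ∂P := by
            refine lintegral_mono fun ω => ?_
            by_cases hω : ω ∈ A R
            · simp only [Set.indicator_of_mem hω, Set.indicator_of_notMem (fun h => h hω :
                ω ∉ (A R)ᶜ), add_zero, ENNReal.coe_le_coe]
              exact min_le_left _ _
            · simp only [Set.indicator_of_notMem hω, Set.indicator_of_mem (show ω ∈ (A R)ᶜ from hω),
                zero_add]
              exact_mod_cast min_le_right (f (q t ω)) (L : NNReal)
        _ = ∫⁻ ω, (A R).indicator (fun ω => (f (q t ω) : ENNReal)) ω ∂P + L * P (A R)ᶜ := by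
            rw [lintegral_add_right _ (measurable_const.indicator (hA R).compl),
              lintegral_indicator_const (hA R).compl]
        _ ≤ _ := add_le_add_left (hbound R t) _
    have h0 : Tendsto (fun R => K + L * P (A R)ᶜ) atTop (𝓝 (K + L * 0)) :=
      tendsto_const_nhds.add (ENNReal.Tendsto.const_mul hA' (Or.inr (ENNReal.natCast_ne_top L)))
    rw [mul_zero, add_zero] at h0
    exact ge_of_tendsto' h0 hstep
  have hsup : ∀ x : NNReal, (x : ENNReal) = ⨆ L : ℕ, ((min x (L : NNReal) : NNReal) : ENNReal) :=
    fun x => by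
      refine le_antisymm ?_ (iSup_le fun L => ENNReal.coe_le_coe.2 (min_le_left _ _))
      obtain ⟨L, hL⟩ := exists_nat_ge x
      exact le_iSup_of_le L (by rw [min_eq_left hL])
  calc ∫⁻ ω, f (qbar ω) ∂P'
      = ∫⁻ ω, ⨆ L : ℕ, ((min (f (qbar ω)) (L : NNReal) : NNReal) : ENNReal) ∂P' :=
        lintegral_congr fun ω => hsup _
    _ = ⨆ L : ℕ, ∫⁻ ω, (min (f (qbar ω)) (L : NNReal) : NNReal) ∂P' := by
        refine lintegral_iSup' (fun L => ?_) (.of_forall fun ω L L' hL => ?_)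
        · exact (Measurable.of_discrete (f := fun x =>
            ((min (f x) (L : NNReal) : NNReal) : ENNReal))).comp_aemeasurable
            hconv.aemeasurable_limit
        · exact ENNReal.coe_le_coe.2 (min_le_min_left _ (Nat.cast_le.2 hL))
    _ ≤ K := iSup_le htrunc

/-- The distance to the cone has a uniformly bounded exponential moment in steady state. -/
theorem HasMargin.lintegral_exp_coneDist_le {I J : Set (Fin n)} {ν l : Vec n} {c : ℝ}
    (h : HasMargin I J ν c) (hl : ‖l - ν‖ ≤ c / 2) {b : ℕ} {Ω Ω' : Type*} [MeasurableSpace Ω]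
    [MeasurableSpace Ω'] {P : Measure Ω} [IsProbabilityMeasure P] {P' : Measure Ω'}
    [IsProbabilityMeasure P'] {a s q : ℕ → Ω → Arr n} (hsw : IsMaxWeightSwitch P a s q)
    (ha : ∀ t i j, ∀ᵐ ω ∂P, a t ω i j ≤ b)
    (hmean : ∀ t i j, ∫ ω, (a t ω i j : ℝ) ∂P = l (i, j)) {qbar : Ω' → Arr n}
    (hconv : TendstoInDistribution q atTop qbar (fun _ => P) P') {θ : ℝ} (hθ : 0 < θ)
    (hθD : θ * (n * (b + 1)) ≤ 1) (hθc : θ * (n * (b + 1)) ^ 2 ≤ c / 8) (hρ : θ * c ≤ 8) :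
    ∫⁻ ω, ENNReal.ofReal (Real.exp (θ * coneDist I J (qbar ω))) ∂P' ≤
      ENNReal.ofReal (Real.exp (θ * (2 * (n * (b + 1)) ^ 2 / c + n * (b + 1) + 1)) /
        (θ * c / 8)) := by
  set B : ℝ := Real.exp (θ * (2 * (n * (b + 1)) ^ 2 / c + n * (b + 1) + 1)) with hB
  have hB0 : 0 < B := Real.exp_pos _
  set δ : ℝ := θ * c / 8 with hδ
  have hδ0 : 0 < δ := by have := h.pos; positivity
  have hδ1 : 0 ≤ 1 - δ := by linarith
  set S : ℕ → Set (Arr n) := fun R => {x | coneDist I J x ≤ R} with hS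
  refine lintegral_limit_le hconv hsw.measurable_queue
    (fun x => (Real.exp (θ * coneDist I J x)).toNNReal) (fun R => q 0 ⁻¹' S R)
    (fun R => hsw.measurable_queue 0 MeasurableSet.of_discrete) ?_
    (fun R t => ENNReal.ofReal ((1 - δ) ^ t * Real.exp (θ * R) + B / δ)) (fun R => ?_)
    fun R t => ?_
  · have hanti : Antitone fun R => (q 0 ⁻¹' S R)ᶜ := fun R R' hR =>
      Set.compl_subset_compl.2 fun ω (hω : coneDist I J (q 0 ω) ≤ R) =>
        hω.trans (Nat.cast_le.2 hR)
    have hempty : ⋂ R, (q 0 ⁻¹' S R)ᶜ = ∅ := by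
      refine Set.eq_empty_iff_forall_notMem.2 fun ω hω => ?_
      obtain ⟨R, hR⟩ := exists_nat_ge (coneDist I J (q 0 ω))
      exact Set.mem_iInter.1 hω R hR
    have := tendsto_measure_iInter_atTop (μ := P)
      (fun R =>
        (hsw.measurable_queue 0 (MeasurableSet.of_discrete (s := S R))).compl.nullMeasurableSet)
      hanti ⟨0, measure_ne_top _ _⟩
    rwa [hempty, measure_empty] at this
  · refine ENNReal.tendsto_ofReal ?_
    have := ((tendsto_pow_atTop_nhds_zero_of_lt_one hδ1 (by linarith)).mul_const
      (Real.exp (θ * R))).add_const (B / δ)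
    simpa using this
  · induction t with
    | zero =>
      calc ∫⁻ ω, (q 0 ⁻¹' S R).indicator
            (fun ω => ((Real.exp (θ * coneDist I J (q 0 ω))).toNNReal : ENNReal)) ω ∂P
          ≤ ∫⁻ _ω, ENNReal.ofReal (Real.exp (θ * R)) ∂P := by
            refine lintegral_mono fun ω => ?_
            by_cases hω : ω ∈ q 0 ⁻¹' S R
            · rw [Set.indicator_of_mem hω]
              exact ENNReal.ofReal_le_ofReal
                (Real.exp_le_exp.2 (mul_le_mul_of_nonneg_left hω hθ.le))
            · rw [Set.indicator_of_notMem hω]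
              exact zero_le
        _ ≤ _ := by
            rw [lintegral_const, measure_univ, mul_one]
            refine ENNReal.ofReal_le_ofReal ?_
            have : 0 ≤ B / δ := by positivity
            linarith
    | succ t ih =>
      refine (hsw.lintegral_step (S R) (fun x => ENNReal.ofReal (Real.exp (θ * coneDist I J x)))
        (ρ := ENNReal.ofReal (1 - δ)) (B := ENNReal.ofReal B) t fun ω => ?_).trans ?_
      · refine (h.lintegral_exp_coneDist_nextQueue_le hl (hsw.schedule_maximal t ω)
          (hsw.maxWeight t ω) (hsw.measurable_arrival t) (ha t) (hmean t) hθ hθD hθc hρ).trans ?_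
        rw [← ENNReal.ofReal_mul hδ1, ← ENNReal.ofReal_add
          (mul_nonneg hδ1 (Real.exp_pos _).le) hB0.le]
      · have hr : 0 ≤ (1 - δ) ^ t * Real.exp (θ * R) + B / δ := by positivity
        refine (add_le_add_left (mul_le_mul_right ih _) _).trans ?_
        rw [← ENNReal.ofReal_mul hδ1, ← ENNReal.ofReal_add (mul_nonneg hδ1 hr) hB0.le]
        -- `B / δ` is the fixed point of `x ↦ (1 - δ) x + B`.
        refine ENNReal.ofReal_le_ofReal (le_of_eq ?_)
        field_simp
        ring

/-! ### Uniformity over a compact set of arrival rates -/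

/-- For all arrival rates in `U`, the norm of the component orthogonal to the cone has in steady
state a common exponential moment with a common bound. -/
def HasUniformExpMoment.{u, v} (n₁ n₂ b : ℕ) (U : Set (Vec n)) : Prop :=
  ∃ θ : ℝ, 0 < θ ∧ ∃ C : ℝ, ∀ l ∈ U,
    ∀ (Ω : Type u) [MeasurableSpace Ω] (P : Measure Ω) [IsProbabilityMeasure P]
      (a s q : ℕ → Ω → Arr n), IsMaxWeightSwitch P a s q →
    (∀ t i j, ∀ᵐ ω ∂P, a t ω i j ≤ b) →
    (∀ t i j, ∫ ω, (a t ω i j : ℝ) ∂P = l (i, j)) →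
    ∀ (Ω' : Type v) [MeasurableSpace Ω'] (P' : Measure Ω') [IsProbabilityMeasure P']
      (qbar : Ω' → Arr n), TendstoInDistribution q atTop qbar (fun _ => P) P' →
    ∫⁻ ω, ENNReal.ofReal (Real.exp (θ * ‖perpCone n₁ n₂ (toVec (qbar ω))‖)) ∂P' ≤
      ENNReal.ofReal C

/-- Positive arrival rates of the capacity region with slacks at least `m` in the unsaturated rows
and columns. -/
def rateSet (n₁ n₂ : ℕ) (m : ℝ) : Set (Vec n) :=
  {l | (∀ p, m ≤ l p) ∧ (∀ i, ∑ j, l (i, j) ≤ 1) ∧ (∀ j, ∑ i, l (i, j) ≤ 1) ∧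
    (∀ i : Fin n, n₁ ≤ (i : ℕ) → ∑ j, l (i, j) ≤ 1 - m) ∧
    ∀ j : Fin n, n₂ ≤ (j : ℕ) → ∑ i, l (i, j) ≤ 1 - m}

theorem isCompact_rateSet {n₁ n₂ : ℕ} {m : ℝ} (hm : 0 < m) :
    IsCompact (rateSet n₁ n₂ m : Set (Vec n)) := by
  refine Metric.isCompact_of_isClosed_isBounded ?_ ?_
  · simp only [rateSet, Set.ofPred_and, Set.ofPred_forall]
    refine (isClosed_iInter fun p => isClosed_le (by fun_prop) (by fun_prop)).inter
      ((isClosed_iInter fun i => isClosed_le (by fun_prop) (by fun_prop)).inter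
      ((isClosed_iInter fun i => isClosed_le (by fun_prop) (by fun_prop)).inter
      ((isClosed_iInter fun i => isClosed_iInter fun _ =>
        isClosed_le (by fun_prop) (by fun_prop)).inter
      (isClosed_iInter fun i => isClosed_iInter fun _ =>
        isClosed_le (by fun_prop) (by fun_prop)))))
  · refine isBounded_iff_forall_norm_le.2 ⟨n * 1, fun l hl => ?_⟩
    refine norm_le_of_forall_abs_le zero_le_one fun p => ?_
    have h0 : ∀ p, 0 ≤ l p := fun p => hm.le.trans (hl.1 p)
    rw [abs_of_nonneg (h0 p)]
    exact (Finset.single_le_sum (f := fun j => l (p.1, j)) (fun j _ => h0 (p.1, j))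
      (Finset.mem_univ p.2)).trans (hl.2.1 p.1)

theorem exists_pos_le_of_finite {ι : Type*} [Finite ι] {f : ι → ℝ} {S : Set ι}
    (h : ∀ i ∈ S, 0 < f i) : ∃ c, 0 < c ∧ ∀ i ∈ S, c ≤ f i := by
  rcases S.eq_empty_or_nonempty with rfl | hne
  · exact ⟨1, one_pos, fun i hi => hi.elim⟩
  · obtain ⟨i, hi, hmin⟩ := Set.exists_min_image S f S.toFinite hne
    exact ⟨f i, h i hi, hmin⟩

/-- Take `I` and `J` to be exactly the saturated rows and columns of `l`; the finitely many
remaining slacks are positive and hence bounded below. -/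
theorem exists_hasMargin {n₁ n₂ : ℕ} {m : ℝ} (hm : 0 < m) (hn : 1 ≤ n) {l : Vec n}
    (hl : l ∈ rateSet n₁ n₂ m) :
    ∃ I J : Set (Fin n), (∀ i ∈ I, (i : ℕ) < n₁) ∧ (∀ j ∈ J, (j : ℕ) < n₂) ∧
      ∃ c ≤ 1, HasMargin I J l c := by
  obtain ⟨h0, hr, hc, hr', hc'⟩ := hl
  refine ⟨{i | ∑ j, l (i, j) = 1}, {j | ∑ i, l (i, j) = 1}, fun i hi => ?_, fun j hj => ?_, ?_⟩
  · by_contra! h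
    linarith [hr' i h, Set.mem_ofPred.1 hi]
  · by_contra! h
    linarith [hc' j h, Set.mem_ofPred.1 hj]
  · obtain ⟨c₁, hc₁, h₁⟩ := exists_pos_le_of_finite (f := fun i => 1 - ∑ j, l (i, j))
      (S := {i | ∑ j, l (i, j) ≠ 1}) fun i hi => sub_pos.2 (lt_of_le_of_ne (hr i) hi)
    obtain ⟨c₂, hc₂, h₂⟩ := exists_pos_le_of_finite (f := fun j => 1 - ∑ i, l (i, j))
      (S := {j | ∑ i, l (i, j) ≠ 1}) fun j hj => sub_pos.2 (lt_of_le_of_ne (hc j) hj)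
    have hn0 : (0 : ℝ) < n := Nat.cast_pos.2 hn
    set c := min (min 1 m) (min (c₁ / n) (c₂ / n)) with hcdef
    have e1 : n * c ≤ c₁ := by
      rw [mul_comm]
      exact (le_div_iff₀ hn0).1 ((min_le_right _ _).trans (min_le_left _ _))
    have e2 : n * c ≤ c₂ := by
      rw [mul_comm]
      exact (le_div_iff₀ hn0).1 ((min_le_right _ _).trans (min_le_right _ _))
    refine ⟨c, (min_le_left _ _).trans (min_le_left _ _), ?_, fun p => ?_, fun i hi => hi,
      fun i hi => ?_, fun j hj => hj, fun j hj => ?_⟩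
    · exact lt_min (lt_min one_pos hm) (lt_min (div_pos hc₁ hn0) (div_pos hc₂ hn0))
    · exact ((min_le_left _ _).trans (min_le_right _ _)).trans (h0 p)
    · linarith [h₁ i hi]
    · linarith [h₂ j hj]

theorem HasMargin.hasUniformExpMoment_closedBall.{u, v} {n₁ n₂ b : ℕ} {I J : Set (Fin n)}
    (hI : ∀ i ∈ I, (i : ℕ) < n₁) (hJ : ∀ j ∈ J, (j : ℕ) < n₂) (hn : 1 ≤ n) {ν : Vec n} {c : ℝ}
    (h : HasMargin I J ν c) (hc1 : c ≤ 1) :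
    HasUniformExpMoment.{u, v} n₁ n₂ b (Metric.closedBall ν (c / 2)) := by
  set D : ℝ := n * (b + 1) with hD
  have hc := h.pos
  have hD1 : 1 ≤ D := by
    have h1 : (1 : ℝ) ≤ n := Nat.one_le_cast.2 hn
    have h2 : (0 : ℝ) ≤ b := Nat.cast_nonneg b
    nlinarith
  have hθ : 0 < c / (8 * D ^ 2) := by positivity
  -- The largest `θ` with `θ * D ^ 2 ≤ c / 8`; the other two smallness conditions follow from `c ≤ 1
  -- ≤ D`.
  refine ⟨c / (8 * D ^ 2), hθ, Real.exp (c / (8 * D ^ 2) * (2 * D ^ 2 / c + D + 1)) /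
    (c / (8 * D ^ 2) * c / 8), ?_⟩
  intro l hl Ω _ P _ a s q hsw ha hmean Ω' _ P' _ qbar hconv
  rw [Metric.mem_closedBall, dist_eq_norm] at hl
  have hθ1 : c / (8 * D ^ 2) ≤ 1 := by
    rw [div_le_one (by positivity)]
    nlinarith
  refine le_trans (lintegral_mono fun ω => ENNReal.ofReal_le_ofReal (Real.exp_le_exp.2
    (mul_le_mul_of_nonneg_left (norm_perpCone_le hI hJ (qbar ω)) hθ.le)))
    (h.lintegral_exp_coneDist_le hl hsw ha hmean hconv hθ ?_ ?_ ?_)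
  · rw [← hD, div_mul_eq_mul_div, div_le_one (by positivity)]
    nlinarith
  · rw [← hD]
    apply le_of_eq
    field_simp
  · nlinarith

theorem HasUniformExpMoment.mono.{u, v} {n₁ n₂ b : ℕ} {U V : Set (Vec n)} (hUV : U ⊆ V)
    (h : HasUniformExpMoment.{u, v} n₁ n₂ b V) : HasUniformExpMoment.{u, v} n₁ n₂ b U := by
  obtain ⟨θ, hθ, C, h⟩ := h
  exact ⟨θ, hθ, C, fun l hl => h l (hUV hl)⟩

theorem HasUniformExpMoment.union.{u, v} {n₁ n₂ b : ℕ} {U V : Set (Vec n)}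
    (hU : HasUniformExpMoment.{u, v} n₁ n₂ b U) (hV : HasUniformExpMoment.{u, v} n₁ n₂ b V) :
    HasUniformExpMoment.{u, v} n₁ n₂ b (U ∪ V) := by
  obtain ⟨θ, hθ, C, hU⟩ := hU
  obtain ⟨θ', hθ', C', hV⟩ := hV
  refine ⟨min θ θ', lt_min hθ hθ', max C C', ?_⟩
  rintro l (hl | hl) Ω _ P _ a s q hsw ha hmean Ω' _ P' _ qbar hconv
  · refine le_trans (lintegral_mono fun ω => ?_)
      ((hU l hl Ω P a s q hsw ha hmean Ω' P' qbar hconv).trans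
        (ENNReal.ofReal_le_ofReal (le_max_left _ _)))
    exact ENNReal.ofReal_le_ofReal (Real.exp_le_exp.2
      (mul_le_mul_of_nonneg_right (min_le_left _ _) (norm_nonneg _)))
  · refine le_trans (lintegral_mono fun ω => ?_)
      ((hV l hl Ω P a s q hsw ha hmean Ω' P' qbar hconv).trans
        (ENNReal.ofReal_le_ofReal (le_max_right _ _)))
    exact ENNReal.ofReal_le_ofReal (Real.exp_le_exp.2
      (mul_le_mul_of_nonneg_right (min_le_right _ _) (norm_nonneg _)))

/-- Compactness: the property holds near each point and passes to finite unions, by taking the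
smaller exponent and the larger bound. -/
theorem hasUniformExpMoment_rateSet.{u, v} {n₁ n₂ b : ℕ} (hn : 1 ≤ n) {m : ℝ} (hm : 0 < m) :
    HasUniformExpMoment.{u, v} n₁ n₂ b (rateSet n₁ n₂ m : Set (Vec n)) := by
  refine (isCompact_rateSet hm).induction_on (p := HasUniformExpMoment.{u, v} n₁ n₂ b)
    ⟨1, one_pos, 0, fun l hl => hl.elim⟩ (fun U V hUV h => h.mono hUV)
    (fun U V hU hV => hU.union hV) fun l hl => ?_
  obtain ⟨I, J, hI, hJ, c, hc1, hc⟩ := exists_hasMargin hm hn hl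
  exact ⟨_, mem_nhdsWithin_of_mem_nhds (Metric.closedBall_mem_nhds l (half_pos hc.pos)),
    hc.hasUniformExpMoment_closedBall hI hJ hn hc1⟩

/-! ### Moments -/

/-- An exponential moment bounds all moments. -/
theorem integrable_pow_of_lintegral_exp_le {Ω : Type*} [MeasurableSpace Ω] {P : Measure Ω}
    {X : Ω → ℝ} (hX : AEMeasurable X P) (hX0 : ∀ ω, 0 ≤ X ω) {θ C : ℝ} (hθ : 0 < θ)
    (h : ∫⁻ ω, ENNReal.ofReal (Real.exp (θ * X ω)) ∂P ≤ ENNReal.ofReal C) (r : ℕ) :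
    Integrable (fun ω => X ω ^ r) P ∧
      ∫ ω, X ω ^ r ∂P ≤ (r.factorial : ℝ) / θ ^ r * max C 0 := by
  have hE : Integrable (fun ω => Real.exp (θ * X ω)) P := by
    refine ⟨(Real.measurable_exp.comp_aemeasurable (hX.const_mul θ)).aestronglyMeasurable, ?_⟩
    rw [hasFiniteIntegral_iff_ofReal (.of_forall fun ω => (Real.exp_pos _).le)]
    exact h.trans_lt ENNReal.ofReal_lt_top
  have hle : ∀ ω, X ω ^ r ≤ (r.factorial : ℝ) / θ ^ r * Real.exp (θ * X ω) := fun ω => by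
    have h1 := Real.pow_div_factorial_le_exp (θ * X ω) (mul_nonneg hθ.le (hX0 ω)) r
    have h2 : X ω ^ r = (r.factorial : ℝ) / θ ^ r * ((θ * X ω) ^ r / r.factorial) := by
      have : (r.factorial : ℝ) ≠ 0 := Nat.cast_ne_zero.2 r.factorial_ne_zero
      rw [mul_pow]
      field_simp
    rw [h2]
    exact mul_le_mul_of_nonneg_left h1 (by positivity)
  have hint : Integrable (fun ω => X ω ^ r) P := by
    refine (hE.const_mul ((r.factorial : ℝ) / θ ^ r)).mono' (hX.pow_const r).aestronglyMeasurable
      (.of_forall fun ω => ?_)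
    rw [Real.norm_of_nonneg (pow_nonneg (hX0 ω) r)]
    exact hle ω
  refine ⟨hint, (integral_mono hint (hE.const_mul _) hle).trans ?_⟩
  rw [integral_const_mul]
  refine mul_le_mul_of_nonneg_left ?_ (by positivity)
  rw [integral_eq_lintegral_of_nonneg_ae (.of_forall fun ω => (Real.exp_pos _).le)
    hE.aestronglyMeasurable]
  refine (ENNReal.toReal_mono ENNReal.ofReal_ne_top h).trans ?_
  rw [ENNReal.toReal_ofReal']

/-! ### Arrival rates near the face -/

theorem nuMin'_le {n₁ n₂ : ℕ} (ν : Vec n) : (∀ p, nuMin' n₁ n₂ ν ≤ ν p) ∧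
    (∀ i : Fin n, n₁ ≤ (i : ℕ) → nuMin' n₁ n₂ ν ≤ 1 - ∑ j, ν (i, j)) ∧
    ∀ j : Fin n, n₂ ≤ (j : ℕ) → nuMin' n₁ n₂ ν ≤ 1 - ∑ i, ν (i, j) := by
  have hb : BddBelow ((Set.range fun p => ν p) ∪
      ((fun i : Fin n => 1 - ∑ j, ν (i, j)) '' {i : Fin n | n₁ ≤ (i : ℕ)} ∪
        (fun j : Fin n => 1 - ∑ i, ν (i, j)) '' {j : Fin n | n₂ ≤ (j : ℕ)})) :=
    ((Set.finite_range _).union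
      ((Set.toFinite _).union (Set.toFinite _))).bddBelow
  exact ⟨fun p => csInf_le hb (Or.inl ⟨p, rfl⟩),
    fun i hi => csInf_le hb (Or.inr (Or.inl ⟨i, hi, rfl⟩)),
    fun j hj => csInf_le hb (Or.inr (Or.inr ⟨j, hj, rfl⟩))⟩

theorem sub_smul_mem_rateSet {n₁ n₂ : ℕ} {ν k : Vec n} (hν : ν ∈ capacityRegion n)
    (hk : ∀ p, 0 ≤ k p) {ε : ℝ} (hε : 0 ≤ ε) (hεk : ε * ‖k‖ ≤ nuMin' n₁ n₂ ν / 2) :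
    ν - ε • k ∈ rateSet n₁ n₂ (nuMin' n₁ n₂ ν / 2) := by
  obtain ⟨h1, h2, h3⟩ := nuMin'_le (n₁ := n₁) (n₂ := n₂) ν
  have hm : 0 ≤ nuMin' n₁ n₂ ν := by
    linarith [mul_nonneg hε (norm_nonneg k)]
  have hrow : ∀ i, ∑ j, (ν - ε • k) (i, j) ≤ ∑ j, ν (i, j) := fun i =>
    Finset.sum_le_sum fun j _ => by
      simpa using mul_nonneg hε (hk (i, j))
  have hcol : ∀ j, ∑ i, (ν - ε • k) (i, j) ≤ ∑ i, ν (i, j) := fun j =>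
    Finset.sum_le_sum fun i _ => by
      simpa using mul_nonneg hε (hk (i, j))
  refine ⟨fun p => ?_, fun i => (hrow i).trans (hν.2.1 i), fun j => (hcol j).trans (hν.2.2 j),
    fun i hi => ?_, fun j hj => ?_⟩
  · have h4 := mul_le_mul_of_nonneg_left
      ((le_abs_self _).trans (PiLp.norm_apply_le k p)) hε
    simp only [PiLp.sub_apply, PiLp.smul_apply, smul_eq_mul]
    linarith [h1 p]
  · linarith [h2 i hi, hrow i]
  · linarith [h3 j hj, hcol j]

end Switch
end

/-! ### State space collapse -/

theorem mainTheorem2 (n n₁ n₂ : ℕ) (hn : 1 ≤ n) (hn₁ : n₁ ≤ n) (hn₂ : n₂ ≤ n)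
    (ν : Switch.Vec n) (hν : ν ∈ intrinsicInterior ℝ (Switch.face n n₁ n₂))
    (hνpos : ∀ p, 0 < ν p) (aMax : ℕ) (σ' : ℝ) :
    -- the bounds `M r` depend only on the data above, not on `k`, `ε` or the arrival laws
    ∃ M : ℕ → ℝ, (∀ r, 0 ≤ M r) ∧
      ∀ k : Switch.Vec n, (∀ p, 0 ≤ k p) → ∑ p, k p = n →
      ∀ ε : ℝ, 0 < ε → ε < 1 → ε ≤ Switch.nuMin' n₁ n₂ ν / (2 * ‖k‖) →
      ∀ (Ω : Type*) [MeasurableSpace Ω] (P : Measure Ω) [IsProbabilityMeasure P]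
        (a s q : ℕ → Ω → Switch.Arr n),
      Switch.IsMaxWeightSwitch P a s q →
      (∀ t i j, ∀ᵐ ω ∂P, a t ω i j ≤ aMax) →
      (∀ t i j, ∫ ω, (a t ω i j : ℝ) ∂P = ν (i, j) - ε * k (i, j)) →
      (∀ t, ∑ i, ∑ j, variance (fun ω => (a t ω i j : ℝ)) P ≤ σ' ^ 2) →
      -- the queue lengths converge in distribution to the steady state vector `qbar`
      ∀ (Ω' : Type*) [MeasurableSpace Ω'] (P' : Measure Ω') [IsProbabilityMeasure P']
        (qbar : Ω' → Switch.Arr n),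
      TendstoInDistribution q atTop qbar (fun _ => P) P' →
      ∀ r : ℕ, 1 ≤ r →
        Integrable (fun ω => ‖Switch.perpSubspace n₁ n₂ (Switch.toVec (qbar ω))‖ ^ r) P' ∧
        Integrable (fun ω => ‖Switch.perpCone n₁ n₂ (Switch.toVec (qbar ω))‖ ^ r) P' ∧
        ∫ ω, ‖Switch.perpSubspace n₁ n₂ (Switch.toVec (qbar ω))‖ ^ r ∂P'
          ≤ ∫ ω, ‖Switch.perpCone n₁ n₂ (Switch.toVec (qbar ω))‖ ^ r ∂P' ∧
        ∫ ω, ‖Switch.perpCone n₁ n₂ (Switch.toVec (qbar ω))‖ ^ r ∂P' ≤ (M r) ^ r := by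
  by_cases hm : 0 < Switch.nuMin' n₁ n₂ ν
  · obtain ⟨θ, hθ, C, hC⟩ :=
      Switch.hasUniformExpMoment_rateSet (n₁ := n₁) (n₂ := n₂) (b := aMax) hn (half_pos hm)
    -- The maximum with `1` ensures `M r ≤ (M r) ^ r` for `r ≥ 1`, so no root is needed.
    refine ⟨fun r => max 1 ((r.factorial : ℝ) / θ ^ r * max C 0),
      fun r => zero_le_one.trans (le_max_left _ _), ?_⟩
    intro k hk hksum ε hε0 _ hε Ω _ P _ a s q hsw ha hmean _ Ω' _ P' _ qbar hconv r hr
    have hk0 : 0 < ‖k‖ := by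
      refine norm_pos_iff.2 fun h => ?_
      rw [h] at hksum
      simp only [PiLp.zero_apply, Finset.sum_const_zero] at hksum
      exact absurd (Nat.cast_eq_zero.1 hksum.symm) (by omega)
    have hεk : ε * ‖k‖ ≤ Switch.nuMin' n₁ n₂ ν / 2 := by
      rw [le_div_iff₀ (by positivity)] at hε
      linarith
    have hl := Switch.sub_smul_mem_rateSet (intrinsicInterior_subset hν).1 hk hε0.le hεk
    have hexp := hC _ hl Ω P a s q hsw ha (fun t i j => by simpa using hmean t i j) Ω' P' qbar hconv
    have hmeas : ∀ f : Switch.Arr n → ℝ, AEMeasurable (fun ω => f (qbar ω)) P' := fun f =>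
      (Measurable.of_discrete (f := f)).comp_aemeasurable hconv.aemeasurable_limit
    obtain ⟨hint, hle⟩ := Switch.integrable_pow_of_lintegral_exp_le
      (hmeas fun x => ‖Switch.perpCone n₁ n₂ (Switch.toVec x)‖) (fun _ => norm_nonneg _) hθ hexp r
    have hpow : ∀ ω, ‖Switch.perpSubspace n₁ n₂ (Switch.toVec (qbar ω))‖ ^ r ≤
        ‖Switch.perpCone n₁ n₂ (Switch.toVec (qbar ω))‖ ^ r := fun ω =>
      pow_le_pow_left₀ (norm_nonneg _) (Switch.norm_perpSubspace_le n₁ n₂ _) r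
    have hintS : Integrable
        (fun ω => ‖Switch.perpSubspace n₁ n₂ (Switch.toVec (qbar ω))‖ ^ r) P' := by
      refine hint.mono'
        (hmeas fun x => ‖Switch.perpSubspace n₁ n₂ (Switch.toVec x)‖ ^ r).aestronglyMeasurable
        (.of_forall fun ω => ?_)
      rw [Real.norm_of_nonneg (pow_nonneg (norm_nonneg _) r)]
      exact hpow ω
    refine ⟨hintS, hint, integral_mono hintS hint hpow, hle.trans ?_⟩
    exact (le_max_right _ _).trans (le_self_pow₀ (le_max_left _ _) (by omega))
  -- With `nuMin'` nonpositive, no `ε > 0` meets its upper bound.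
  · refine ⟨fun _ => 0, fun _ => le_rfl, ?_⟩
    intro k _ _ ε hε0 _ hε
    exact absurd (hε.trans (div_nonpos_of_nonpos_of_nonneg (not_lt.1 hm) (by positivity)))
      (not_le.2 hε0)
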